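/- Let $\lambda>0$, $K>0$, and let $\mathcal P_\lambda$ be a homogeneous Poisson process of intensity $\lambda$ on $\mathbb R^2$. Let $g:[0,\infty)\to[0,1)$ be non-increasing (with $g(0)=M<1$), and let $$f(x)=\log(1-x^2)+\frac{2x^2}{K(1-x^2)}.$$ Let $\mathrm{NNG}(V)$ denote the undirected nearest-neighbour graph on a point set $V$: distinct $x,y\in V$ are joined if and only if $y$ is a nearest neighbour of $x$ in $V$ or $x$ is a nearest neighbour of $y$ in $V$. For an edge $(\mathbf 0,\mathbf X)$ let $R_{\mathbf 0,\mathbf X}=|\mathbf X|$ be its length. Let $$\omega=\frac{4\pi}{3}+\frac{\sqrt3}{2}.$$ Then $\omega$ is the area of the union of two unit disks whose centres are at unit distance; almost surely only finitely many points of $\mathcal P_\lambda$ are joined to the origin in $\mathrm{NNG}(\mathcal P_\lambda\cup\{\mathbf 0\})$; and $$\frac12\,\mathbb E\sum_{\substack{\mathbf X\in\mathcal P_\lambda\\ (\mathbf 0,\mathbf X)\in \mathrm{NNG}(\mathcal P_\lambda\cup\{\mathbf 0\})}} f\bigl(g(R_{\mathbf 0,\mathbf X})\bigr)=\mathbb E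 f(g(Z_1))-\frac{\pi}{2\omega}\,\mathbb E f(g(Z_2)),$$ where all three expectations exist and are finite. Here $Z_1$ and $Z_2$ are Rayleigh random variables with parameters $\sigma^2=(2\pi\lambda)^{-1}$ and $\sigma^2=(2\omega\lambda)^{-1}$ respectively; the Rayleigh law with parameter $\sigma^2$ has density $\frac{z}{\sigma^2}e^{-z^2/(2\sigma^2)}$ on $[0,\infty)$, so that $\mathbb P[Z_1>z]=e^{-\pi\lambda z^2}$ and $\mathbb P[Z_2>z]=e^{-\omega\lambda z^2}$ for $z\ge 0$. -/

import Mathlib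

open MeasureTheory ProbabilityTheory Set Filter
open scoped NNReal ENNReal Topology

noncomputable section

/-- The Euclidean plane. -/
abbrev Plane : Type := EuclideanSpace ℝ (Fin 2)

/-- A random set of points `P` in the plane, defined on the probability space `(Ω, μ)`, is a
homogeneous Poisson process of intensity `lam`: the number of points in each Borel set is a random
variable, it is Poisson distributed with mean `lam * area` when the area is finite, and the numbers
of points in finitely many pairwise disjoint Borel sets are mutually independent. -/
structure IsPoissonProcess {Ω : Type*} [MeasurableSpace Ω] (μ : Measure Ω) (lam : ℝ≥0)
    (P : Ω → Set Plane) : Prop where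
  measurable_count : ∀ A : Set Plane, MeasurableSet A →
    Measurable (fun w => (P w ∩ A).encard)
  count_law : ∀ A : Set Plane, MeasurableSet A → volume A < ∞ →
    HasLaw (fun w => (P w ∩ A).encard)
      ((poissonMeasure (lam * (volume A).toNNReal)).map (Nat.cast : ℕ → ℕ∞)) μ
  indep_count : ∀ (n : ℕ) (A : Fin n → Set Plane), (∀ i, MeasurableSet (A i)) →
    Pairwise (fun i j => Disjoint (A i) (A j)) →
    iIndepFun (fun i w => (P w ∩ A i).encard) μ

/-- `y` is a nearest neighbour of `x` in the point set `V`. -/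
def IsNearestNeighbor {E : Type*} [MetricSpace E] (V : Set E) (x y : E) : Prop :=
  y ∈ V ∧ y ≠ x ∧ ∀ z ∈ V, z ≠ x → dist x y ≤ dist x z

/-- The undirected nearest-neighbour graph on the point set `V`: distinct points `x` and `y` of `V`
are joined iff one of them is a nearest neighbour of the other. (Points outside `V` are isolated.) -/
def nearestNeighborGraph {E : Type*} [MetricSpace E] (V : Set E) : SimpleGraph E where
  Adj x y := x ∈ V ∧ y ∈ V ∧ x ≠ y ∧ (IsNearestNeighbor V x y ∨ IsNearestNeighbor V y x)
  symm := ⟨fun _ _ h => ⟨h.2.1, h.1, h.2.2.1.symm, h.2.2.2.symm⟩⟩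
  loopless := ⟨fun _ h => h.2.2.1 rfl⟩

/-- The points of `V` that are joined to the origin in the undirected nearest-neighbour graph on
`V ∪ {0}`. -/
def originNeighbors (V : Set Plane) : Set Plane :=
  {x | x ∈ V ∧ (nearestNeighborGraph (V ∪ {0})).Adj 0 x}

/-- The function `f(x) = log (1 - x²) + 2 x² / (K (1 - x²))`. -/
def edgeFun (K x : ℝ) : ℝ :=
  Real.log (1 - x ^ 2) + 2 * x ^ 2 / (K * (1 - x ^ 2))

/-- The edge functional at the origin: the sum of `f (g (R))` over the edges of the undirected
nearest-neighbour graph on `V ∪ {0}` that join the origin to a point of `V`, where `R` is the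
length of the edge. -/
def originEdgeSum (K : ℝ) (g : ℝ → ℝ) (V : Set Plane) : ℝ :=
  ∑' x : originNeighbors V, edgeFun K (g (dist (0 : Plane) (x : Plane)))

/-- The Rayleigh distribution with parameter `s = σ²`, the law of the norm of a centred Gaussian
vector in the plane whose two independent coordinates have variance `s`. Its density is
`(z / s) * exp (- z² / (2 s))` for `z ≥ 0`. -/
def rayleighMeasure (s : ℝ) : Measure ℝ :=
  volume.withDensity fun z =>
    if 0 ≤ z then ENNReal.ofReal (z / s * Real.exp (-z ^ 2 / (2 * s))) else 0

/-- The constant `ω = 4π/3 + √3/2`. -/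
def nngOmega : ℝ := 4 * Real.pi / 3 + √3 / 2

end

/-!
For a relation `R`, let `voidPoints R V` be the set of points `x` of `V` such that no other point
`y` of `V` has `(x, y) ∈ R`. When the origin is not in `V`, which holds almost surely, the points
whose nearest neighbour is the origin, and the nearest neighbours of the origin, are
`voidPoints R V` for two open relations `R`: "`y` is closer to `x` than the origin is" and "`y` is
closer to the origin than `x` is". The points that are joined to the origin for both reasons are
those of `voidPoints R V` for the union of the two relations, so by inclusion–exclusion
(`originEdgeSum_eq`) the edge functional is a combination of three sums of the same kind.

Each of them is evaluated by Mecke's formula (`IsPoissonProcess.bind_voidMeasure`): the expected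
counting measure of `voidPoints R P` has density `lam * exp (-lam * |R x|)` at `x`, where `|R x|`
is the area of the section of `R` at `x`. It is proved by discretization. The plane is cut into
small cells, and a point in a cell is counted when the process has no point in the inner region of
the cell, the set of points off the cell that are related to everything near the cell. The inner
region is disjoint from the cell, so independence of the two counts gives the expectation. As the
cells shrink, the inner region of the cell of `x` stays inside `R x` without `x`, and every point of
the latter lies in it eventually, because `R` is open; so both sides converge. Pairs on the boundary
of `R` need no separate treatment, and the discretized counts also give the measurability of the
limit.

The sections are two disks of radius `‖x‖`, of area `π * ‖x‖ ^ 2`, and their union, of area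
`nngOmega * ‖x‖ ^ 2` (`volume_ball_zero_union_ball_norm`). In polar coordinates the three densities
become multiples of Rayleigh densities (`integral_withDensity_voidDensity`).
-/

/-! ### Counts of a Poisson process -/

lemma lintegral_natCast_poissonMeasure (r : ℝ≥0) :
    ∫⁻ n : ℕ, (n : ℝ≥0∞) ∂poissonMeasure r = r := by
  have hstep (n : ℕ) : ((n + 1 : ℕ) : ℝ≥0∞) * poissonMeasure r {n + 1} =
      r * poissonMeasure r {n} := by
    rw [poissonMeasure_singleton, poissonMeasure_singleton, ← ENNReal.ofReal_natCast,
      ← ENNReal.ofReal_coe_nnreal, ← ENNReal.ofReal_mul (by positivity),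
      ← ENNReal.ofReal_mul (by positivity)]
    congr 1
    rw [Nat.factorial_succ]
    push_cast
    field_simp
    ring
  rw [lintegral_countable', tsum_eq_zero_add' ENNReal.summable]
  simp_rw [hstep]
  rw [ENNReal.tsum_mul_left]
  have : ∑' n, poissonMeasure r {n} = 1 := by
    have h := lintegral_countable' (μ := poissonMeasure r) (fun _ => 1)
    simpa using h.symm
  simp [this]

/-- The indicator of the event that the point set `V` has no point in `A`. -/
noncomputable def voidIndicator (V A : Set Plane) : ℝ≥0∞ :=
  ({0} : Set ℕ∞).indicator 1 (V ∩ A).encard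

lemma voidIndicator_le_one (V A : Set Plane) : voidIndicator V A ≤ 1 :=
  indicator_apply_le' (fun _ => le_rfl) (fun _ => zero_le)

lemma voidIndicator_of_disjoint {V A : Set Plane} (h : ∀ y ∈ V, y ∉ A) :
    voidIndicator V A = 1 := by
  have : V ∩ A = ∅ := by
    ext y; simpa using h y
  simp [voidIndicator, this]

lemma voidIndicator_of_mem {V A : Set Plane} {y : Plane} (hV : y ∈ V) (hA : y ∈ A) :
    voidIndicator V A = 0 := by
  refine indicator_of_notMem ?_ _
  have hne : (V ∩ A).Nonempty := ⟨y, hV, hA⟩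
  simpa [Set.encard_eq_zero] using hne.ne_empty

namespace IsPoissonProcess

variable {Ω : Type*} [MeasurableSpace Ω] {μ : Measure Ω} {lam : ℝ≥0} {P : Ω → Set Plane}

lemma measurable_voidIndicator (hP : IsPoissonProcess μ lam P) {A : Set Plane}
    (hA : MeasurableSet A) : Measurable fun w => voidIndicator (P w) A :=
  (measurable_of_countable (({0} : Set ℕ∞).indicator (1 : ℕ∞ → ℝ≥0∞))).comp
    (hP.measurable_count A hA)

lemma measurable_encard (hP : IsPoissonProcess μ lam P) {A : Set Plane}
    (hA : MeasurableSet A) : Measurable fun w => ((P w ∩ A).encard : ℝ≥0∞) :=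
  (measurable_of_countable (fun n : ℕ∞ => (n : ℝ≥0∞))).comp (hP.measurable_count A hA)

lemma lintegral_encard (hP : IsPoissonProcess μ lam P) {A : Set Plane} (hA : MeasurableSet A)
    (hfin : volume A < ∞) : ∫⁻ w, ((P w ∩ A).encard : ℝ≥0∞) ∂μ = lam * volume A := by
  rw [(hP.count_law A hA hfin).lintegral_comp (f := fun n : ℕ∞ => (n : ℝ≥0∞))
    (measurable_of_countable _).aemeasurable,
    lintegral_map (measurable_of_countable _) (measurable_of_countable _)]
  simp [lintegral_natCast_poissonMeasure, ENNReal.coe_toNNReal hfin.ne]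

lemma lintegral_voidIndicator (hP : IsPoissonProcess μ lam P) {A : Set Plane}
    (hA : MeasurableSet A) (hfin : volume A < ∞) :
    ∫⁻ w, voidIndicator (P w) A ∂μ = ENNReal.ofReal (Real.exp (-(lam * volume.real A))) := by
  unfold voidIndicator
  rw [(hP.count_law A hA hfin).lintegral_comp (measurable_of_countable _).aemeasurable,
    lintegral_indicator_one (measurableSet_singleton _),
    Measure.map_apply (measurable_of_countable _) (measurableSet_singleton _)]
  have : (Nat.cast : ℕ → ℕ∞) ⁻¹' {0} = {0} := by ext; simp
  rw [this, poissonMeasure_singleton]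
  simp [measureReal_def]
  rfl

lemma ae_finite_inter (hP : IsPoissonProcess μ lam P) {A : Set Plane} (hA : MeasurableSet A)
    (hfin : volume A < ∞) : ∀ᵐ w ∂μ, (P w ∩ A).Finite := by
  have h : ∫⁻ w, ((P w ∩ A).encard : ℝ≥0∞) ∂μ ≠ ∞ := by
    rw [hP.lintegral_encard hA hfin]
    finiteness
  filter_upwards [ae_lt_top (hP.measurable_encard hA) h] with w hw
  rw [← Set.encard_lt_top_iff]
  simpa using hw

/-- Counts in disjoint sets are independent, so the expected number of points in `A` on the event
that `B` is empty factorizes. -/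
lemma lintegral_voidIndicator_mul_encard (hP : IsPoissonProcess μ lam P) {A B : Set Plane}
    (hA : MeasurableSet A) (hAfin : volume A < ∞) (hB : MeasurableSet B) (hBfin : volume B < ∞)
    (hAB : Disjoint A B) :
    ∫⁻ w, voidIndicator (P w) B * (P w ∩ A).encard ∂μ =
      ENNReal.ofReal (Real.exp (-(lam * volume.real B))) * (lam * volume A) := by
  have hind := hP.indep_count 2 ![B, A] (by simp [Fin.forall_fin_two, hA, hB]) (by
    intro i j hij
    fin_cases i <;> fin_cases j <;> simp_all [disjoint_comm])
  have h01 : IndepFun (fun w => (P w ∩ B).encard) (fun w => (P w ∩ A).encard) μ := by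
    simpa using hind.indepFun (i := 0) (j := 1) (by simp)
  have := lintegral_mul_eq_lintegral_mul_lintegral_of_indepFun (hP.measurable_voidIndicator hB)
    (hP.measurable_encard hA)
    (h01.comp (φ := ({0} : Set ℕ∞).indicator (1 : ℕ∞ → ℝ≥0∞))
      (ψ := fun n : ℕ∞ => (n : ℝ≥0∞)) (measurable_of_countable _) (measurable_of_countable _))
  rw [← hP.lintegral_voidIndicator hB hBfin, ← hP.lintegral_encard hA hAfin]
  exact this

end IsPoissonProcess

/-! ### Partitions into small cells -/

lemma exists_measurable_index {ε : ℝ} (hε : 0 < ε) :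
    ∃ (k : Plane → ℕ) (c : ℕ → Plane), Measurable k ∧ ∀ x, dist x (c (k x)) < ε := by
  classical
  have hex (x : Plane) : ∃ j, dist x (TopologicalSpace.denseSeq Plane j) < ε :=
    (TopologicalSpace.denseRange_denseSeq Plane).exists_dist_lt x hε
  refine ⟨fun x => Nat.find (hex x), TopologicalSpace.denseSeq Plane,
    measurable_find hex fun j => ?_, fun x => Nat.find_spec (hex x)⟩
  exact measurableSet_lt (by fun_prop) measurable_const

/-- For a partition of the plane into the cells `k ⁻¹' {j}`, where the cell `j` lies in the ball of
radius `ε` about `c j`: the points `y` off the cell `j` that are `R`-related to every point of that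
ball. -/
def innerRegion (R : Set (Plane × Plane)) (k : Plane → ℕ) (c : ℕ → Plane) (ε : ℝ) (j : ℕ) :
    Set Plane :=
  {y | ∀ x ∈ Metric.closedBall (c j) ε, (x, y) ∈ R} \ k ⁻¹' {j}

lemma measurableSet_innerRegion {R : Set (Plane × Plane)} (hR : IsOpen R) {k : Plane → ℕ}
    (hk : Measurable k) (c : ℕ → Plane) (ε : ℝ) (j : ℕ) :
    MeasurableSet (innerRegion R k c ε j) := by
  refine MeasurableSet.diff (IsOpen.measurableSet ?_) (hk (measurableSet_singleton j))
  rw [isOpen_iff_eventually]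
  intro y hy
  refine (isCompact_closedBall (c j) ε).eventually_forall_of_forall_eventually
    (P := fun y x => (x, y) ∈ R) fun x hx => ?_
  exact (continuous_swap.isOpen_preimage R hR).mem_nhds (hy x hx)

lemma mem_of_mem_innerRegion {R : Set (Plane × Plane)} {k : Plane → ℕ} {c : ℕ → Plane} {ε : ℝ}
    (hkc : ∀ x, dist x (c (k x)) < ε) {x y : Plane} (hy : y ∈ innerRegion R k c ε (k x)) :
    (x, y) ∈ R ∧ y ≠ x :=
  ⟨hy.1 x (hkc x).le, fun h => hy.2 (by simp [h])⟩

lemma eventually_mem_innerRegion {R : Set (Plane × Plane)} (hR : IsOpen R) {k : ℕ → Plane → ℕ}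
    {c : ℕ → ℕ → Plane} {ε : ℕ → ℝ} (hε : Tendsto ε atTop (𝓝 0))
    (hkc : ∀ n x, dist x (c n (k n x)) < ε n) {x y : Plane} (hxy : (x, y) ∈ R) (hne : y ≠ x) :
    ∀ᶠ n in atTop, y ∈ innerRegion R (k n) (c n) (ε n) (k n x) := by
  have hnhds : ∀ᶠ x' in 𝓝 x, (x', y) ∈ R :=
    (hR.preimage (by fun_prop : Continuous fun x' : Plane => (x', y))).mem_nhds hxy
  obtain ⟨δ, hδ, hball⟩ := Metric.eventually_nhds_iff.1 hnhds
  have h0 : 0 < min (δ / 2) (dist y x / 2) := by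
    have := dist_pos.2 hne
    positivity
  filter_upwards [hε.eventually (gt_mem_nhds h0)] with n hn
  have h1 := hn.trans_le (min_le_left _ _)
  have h2 := hn.trans_le (min_le_right _ _)
  refine ⟨fun x' hx' => hball ?_, fun hcell => ?_⟩
  · have := hkc n x
    have := dist_triangle_right x' x (c n (k n x))
    rw [Metric.mem_closedBall] at hx'
    linarith
  · have h3 := hkc n x
    have h4 := hkc n y
    rw [show k n y = k n x from hcell] at h4
    have := dist_triangle_right y x (c n (k n x))
    linarith

/-! ### The Mecke formula for points with an empty neighbourhood -/

/-- The points `x` of `V` that are not `R`-related to any other point of `V`. -/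
def voidPoints (R : Set (Plane × Plane)) (V : Set Plane) : Set Plane :=
  {x | x ∈ V ∧ ∀ y ∈ V, y ≠ x → (x, y) ∉ R}

lemma lintegral_comp_index (m : Measure Plane) {k : Plane → ℕ} (hk : Measurable k)
    (φ : ℕ → ℝ≥0∞) : ∫⁻ x, φ (k x) ∂m = ∑' j, φ j * m (k ⁻¹' {j}) := by
  rw [← lintegral_map (measurable_of_countable φ) hk, lintegral_countable']
  simp_rw [Measure.map_apply hk (measurableSet_singleton _)]

/-- As the cells shrink, the number of points of `A` whose cell has an inner region without points
of `V` tends to the number of points of `A` that are not related to another point. -/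
lemma tendsto_tsum_voidIndicator {R : Set (Plane × Plane)} (hR : IsOpen R) {k : ℕ → Plane → ℕ}
    (hk : ∀ n, Measurable (k n)) {c : ℕ → ℕ → Plane} {ε : ℕ → ℝ} (hε : Tendsto ε atTop (𝓝 0))
    (hkc : ∀ n x, dist x (c n (k n x)) < ε n) {V A : Set Plane} (hVA : (V ∩ A).Finite) :
    Tendsto (fun n => ∑' j, voidIndicator V (innerRegion R (k n) (c n) (ε n) j) *
      (V ∩ (A ∩ k n ⁻¹' {j})).encard) atTop (𝓝 ((voidPoints R V ∩ A).encard : ℝ≥0∞)) := by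
  set m : Measure Plane := Measure.count.restrict (V ∩ A) with hm
  have hsum (n : ℕ) : ∑' j, voidIndicator V (innerRegion R (k n) (c n) (ε n) j) *
      (V ∩ (A ∩ k n ⁻¹' {j})).encard =
      ∫⁻ x, voidIndicator V (innerRegion R (k n) (c n) (ε n) (k n x)) ∂m := by
    rw [lintegral_comp_index m (hk n)
      (fun j => voidIndicator V (innerRegion R (k n) (c n) (ε n) j))]
    congr 1 with j
    have hj := hk n (measurableSet_singleton j)
    rw [hm, Measure.restrict_apply hj,
      Measure.count_apply (hj.inter hVA.measurableSet), ← inter_assoc V, inter_comm (V ∩ A)]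
  have hlim : ((voidPoints R V ∩ A).encard : ℝ≥0∞) =
      ∫⁻ x, (voidPoints R V ∩ A).indicator 1 x ∂m := by
    have hfin : (voidPoints R V ∩ A).Finite := hVA.subset fun x hx => ⟨hx.1.1, hx.2⟩
    rw [lintegral_indicator_one hfin.measurableSet, hm,
      Measure.restrict_apply hfin.measurableSet,
      Measure.count_apply (hfin.measurableSet.inter hVA.measurableSet)]
    have hsub : voidPoints R V ∩ A ⊆ V ∩ A := fun x hx => ⟨hx.1.1, hx.2⟩
    rw [inter_eq_left.2 hsub]
  simp_rw [hsum]
  rw [hlim]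
  refine tendsto_lintegral_of_dominated_convergence (fun _ => 1) (fun n => ?_) (fun n => ?_) ?_ ?_
  · exact (measurable_of_countable
      (fun j => voidIndicator V (innerRegion R (k n) (c n) (ε n) j))).comp (hk n)
  · exact Eventually.of_forall fun x => voidIndicator_le_one _ _
  · rw [lintegral_one, hm, Measure.restrict_apply_univ, Measure.count_apply hVA.measurableSet]
    simpa using hVA
  · filter_upwards [ae_restrict_mem hVA.measurableSet] with x hx
    by_cases hvoid : x ∈ voidPoints R V
    · rw [indicator_of_mem (show x ∈ voidPoints R V ∩ A from ⟨hvoid, hx.2⟩)]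
      refine tendsto_const_nhds.congr fun n => (voidIndicator_of_disjoint fun y hy hyI => ?_).symm
      obtain ⟨hyR, hyx⟩ := mem_of_mem_innerRegion (hkc n) hyI
      exact hvoid.2 y hy hyx hyR
    · rw [indicator_of_notMem fun h => hvoid h.1]
      obtain ⟨y, hy, hyx, hyR⟩ : ∃ y ∈ V, y ≠ x ∧ (x, y) ∈ R := by
        by_contra! h
        exact hvoid ⟨hx.1, h⟩
      refine tendsto_const_nhds.congr' ?_
      filter_upwards [eventually_mem_innerRegion hR hε hkc hyR hyx] with n hn
      exact (voidIndicator_of_mem hy hn).symm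

lemma volume_innerRegion_le {R : Set (Plane × Plane)} {k : Plane → ℕ} {c : ℕ → Plane} {ε : ℝ}
    (hkc : ∀ x, dist x (c (k x)) < ε) (x : Plane) :
    volume (innerRegion R k c ε (k x)) ≤ volume {y | (x, y) ∈ R} :=
  measure_mono fun _ hy => (mem_of_mem_innerRegion hkc hy).1

lemma tendsto_volume_innerRegion {R : Set (Plane × Plane)} (hR : IsOpen R) {k : ℕ → Plane → ℕ}
    (hk : ∀ n, Measurable (k n)) {c : ℕ → ℕ → Plane} {ε : ℕ → ℝ} (hε : Tendsto ε atTop (𝓝 0))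
    (hkc : ∀ n x, dist x (c n (k n x)) < ε n) {x : Plane}
    (hx : volume {y | (x, y) ∈ R} < ∞) :
    Tendsto (fun n => volume.real (innerRegion R (k n) (c n) (ε n) (k n x))) atTop
      (𝓝 (volume.real {y | (x, y) ∈ R})) := by
  have hmeas : MeasurableSet {y | (x, y) ∈ R} :=
    (hR.preimage (by fun_prop : Continuous fun y : Plane => (x, y))).measurableSet
  refine (ENNReal.tendsto_toReal hx.ne).comp
    (tendsto_measure_of_ae_tendsto_indicator atTop hmeas
      (fun n => measurableSet_innerRegion hR (hk n) _ _ _) hmeas hx.ne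
      (Eventually.of_forall fun n y hy => (mem_of_mem_innerRegion (hkc n) hy).1) ?_)
  filter_upwards [compl_mem_ae_iff.2 (measure_singleton x)] with y hy
  by_cases hyR : (x, y) ∈ R
  · filter_upwards [eventually_mem_innerRegion hR hε hkc hyR hy] with n hn
    simp [hn, hyR]
  · refine Eventually.of_forall fun n => ?_
    simpa [hyR] using fun h => hyR (mem_of_mem_innerRegion (hkc n) h).1

lemma exists_measurable_index_seq :
    ∃ (k : ℕ → Plane → ℕ) (c : ℕ → ℕ → Plane) (ε : ℕ → ℝ), (∀ n, Measurable (k n)) ∧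
      Tendsto ε atTop (𝓝 0) ∧ ∀ n x, dist x (c n (k n x)) < ε n := by
  choose k c hk hkc using fun n : ℕ =>
    exists_measurable_index (ε := 1 / ((n : ℝ) + 1)) (by positivity)
  exact ⟨k, c, _, hk, tendsto_one_div_add_atTop_nhds_zero_nat, hkc⟩

/-- The density, at `x`, of the expected number of points of a Poisson process that are not
`R`-related to any other point. -/
noncomputable def voidDensity (lam : ℝ≥0) (R : Set (Plane × Plane)) (x : Plane) : ℝ≥0∞ :=
  ENNReal.ofReal (Real.exp (-(lam * volume.real {y | (x, y) ∈ R}))) * lam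

lemma measurable_voidDensity (lam : ℝ≥0) {R : Set (Plane × Plane)} (hR : IsOpen R) :
    Measurable (voidDensity lam R) := by
  have : Measurable fun x : Plane => volume.real {y : Plane | (x, y) ∈ R} :=
    (measurable_measure_prodMk_left (ν := (volume : Measure Plane)) hR.measurableSet).ennreal_toReal
  unfold voidDensity
  fun_prop

/-- A set of points that has only finitely many points in each ball. -/
def IsLocallyFinite (V : Set Plane) : Prop :=
  ∀ n : ℕ, (V ∩ Metric.closedBall 0 n).Finite

lemma IsLocallyFinite.countable {V : Set Plane} (hV : IsLocallyFinite V) : V.Countable := by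
  have : V = ⋃ n : ℕ, V ∩ Metric.closedBall 0 n := by
    rw [← inter_iUnion, Metric.iUnion_closedBall_nat, inter_univ]
  rw [this]
  exact countable_iUnion fun n => (hV n).countable

lemma voidPoints_subset (R : Set (Plane × Plane)) (V : Set Plane) : voidPoints R V ⊆ V :=
  fun _ hx => hx.1

lemma IsLocallyFinite.measurableSet_voidPoints {V : Set Plane} (hV : IsLocallyFinite V)
    (R : Set (Plane × Plane)) : MeasurableSet (voidPoints R V) :=
  (hV.countable.mono (voidPoints_subset R V)).measurableSet

open Classical in
/-- The counting measure on `voidPoints R V`, replaced by `0` when `V` is not locally finite: this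
makes it a measurable function of a Poisson process on the whole probability space. -/
noncomputable def voidMeasure (R : Set (Plane × Plane)) (V : Set Plane) : Measure Plane :=
  if IsLocallyFinite V then Measure.count.restrict (voidPoints R V) else 0

lemma IsLocallyFinite.voidMeasure_eq {V : Set Plane} (hV : IsLocallyFinite V)
    (R : Set (Plane × Plane)) : voidMeasure R V = Measure.count.restrict (voidPoints R V) :=
  if_pos hV

lemma IsLocallyFinite.voidMeasure_apply {V : Set Plane} (hV : IsLocallyFinite V)
    (R : Set (Plane × Plane)) {A : Set Plane} (hA : MeasurableSet A) :
    voidMeasure R V A = (voidPoints R V ∩ A).encard := by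
  rw [hV.voidMeasure_eq, Measure.restrict_apply hA,
    Measure.count_apply (hA.inter (hV.measurableSet_voidPoints R)), inter_comm]

namespace IsPoissonProcess

variable {Ω : Type*} [MeasurableSpace Ω] {μ : Measure Ω} {lam : ℝ≥0} {P : Ω → Set Plane}

lemma ae_isLocallyFinite (hP : IsPoissonProcess μ lam P) : ∀ᵐ w ∂μ, IsLocallyFinite (P w) :=
  ae_all_iff.2 fun _ => hP.ae_finite_inter measurableSet_closedBall measure_closedBall_lt_top

lemma measurableSet_isLocallyFinite (hP : IsPoissonProcess μ lam P) :
    MeasurableSet {w | IsLocallyFinite (P w)} := by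
  have : {w | IsLocallyFinite (P w)} =
      ⋂ n : ℕ, (fun w => (P w ∩ Metric.closedBall 0 n).encard) ⁻¹' {⊤}ᶜ := by
    ext w
    simp [IsLocallyFinite]
  rw [this]
  exact MeasurableSet.iInter fun n =>
    hP.measurable_count _ measurableSet_closedBall (measurableSet_singleton _).compl

lemma measurable_voidIndicator_mul_encard (hP : IsPoissonProcess μ lam P)
    {R : Set (Plane × Plane)} (hR : IsOpen R) {k : Plane → ℕ} (hk : Measurable k)
    (c : ℕ → Plane) (ε : ℝ) {A : Set Plane} (hA : MeasurableSet A) (j : ℕ) :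
    Measurable fun w => voidIndicator (P w) (innerRegion R k c ε j) *
      ((P w ∩ (A ∩ k ⁻¹' {j})).encard : ℝ≥0∞) :=
  (hP.measurable_voidIndicator (measurableSet_innerRegion hR hk c ε j)).mul
    (hP.measurable_encard (hA.inter (hk (measurableSet_singleton j))))

lemma measurable_tsum_voidIndicator (hP : IsPoissonProcess μ lam P) {R : Set (Plane × Plane)}
    (hR : IsOpen R) {k : Plane → ℕ} (hk : Measurable k) (c : ℕ → Plane) (ε : ℝ) {A : Set Plane}
    (hA : MeasurableSet A) :
    Measurable fun w => ∑' j, voidIndicator (P w) (innerRegion R k c ε j) *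
      ((P w ∩ (A ∩ k ⁻¹' {j})).encard : ℝ≥0∞) :=
  Measurable.tsum fun j => hP.measurable_voidIndicator_mul_encard hR hk c ε hA j

/-- The expectation of the discretized count: the points of `A` are grouped by cells, and the
region of a cell, being disjoint from it, is empty independently of the count in the cell. -/
lemma lintegral_tsum_voidIndicator (hP : IsPoissonProcess μ lam P) {R : Set (Plane × Plane)}
    (hR : IsOpen R) (hfin : ∀ x, volume {y | (x, y) ∈ R} < ∞) {k : Plane → ℕ} (hk : Measurable k)
    {c : ℕ → Plane} {ε : ℝ} (hkc : ∀ x, dist x (c (k x)) < ε) {A : Set Plane}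
    (hA : MeasurableSet A) (hAfin : volume A < ∞) :
    ∫⁻ w, ∑' j, voidIndicator (P w) (innerRegion R k c ε j) *
        (P w ∩ (A ∩ k ⁻¹' {j})).encard ∂μ =
      ∫⁻ x in A, ENNReal.ofReal
        (Real.exp (-(lam * volume.real (innerRegion R k c ε (k x))))) * lam := by
  rw [lintegral_tsum fun j =>
      (hP.measurable_voidIndicator_mul_encard hR hk c ε hA j).aemeasurable,
    lintegral_comp_index (volume.restrict A) hk
      (fun j => ENNReal.ofReal (Real.exp (-(lam * volume.real (innerRegion R k c ε j)))) * lam)]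
  congr 1 with j
  have hj := hk (measurableSet_singleton j)
  rw [Measure.restrict_apply hj, inter_comm _ A]
  rcases (k ⁻¹' {j}).eq_empty_or_nonempty with hempty | ⟨x, hx⟩
  · simp [hempty]
  · have hfinI : volume (innerRegion R k c ε j) < ∞ := by
      obtain rfl : k x = j := hx
      exact (volume_innerRegion_le hkc x).trans_lt (hfin x)
    rw [hP.lintegral_voidIndicator_mul_encard (hA.inter hj)
      ((measure_mono inter_subset_left).trans_lt hAfin)
      (measurableSet_innerRegion hR hk c ε j) hfinI, mul_assoc]
    exact disjoint_left.2 fun y hy hyI => hyI.2 hy.2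

lemma measurable_voidMeasure (hP : IsPoissonProcess μ lam P) {R : Set (Plane × Plane)}
    (hR : IsOpen R) : Measurable fun w => voidMeasure R (P w) := by
  have hbdd (n : ℕ) {A : Set Plane} (hA : MeasurableSet A) (hAn : A ⊆ Metric.closedBall 0 n) :
      Measurable fun w => voidMeasure R (P w) A := by
    obtain ⟨k, c, ε, hk, hε, hkc⟩ := exists_measurable_index_seq
    refine measurable_of_tendsto_metrizable (f := fun n => {w | IsLocallyFinite (P w)}.indicator
      fun w => ∑' j, voidIndicator (P w) (innerRegion R (k n) (c n) (ε n) j) *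
        ((P w ∩ (A ∩ k n ⁻¹' {j})).encard : ℝ≥0∞))
      (fun n => (hP.measurable_tsum_voidIndicator hR (hk n) (c n) (ε n) hA).indicator
        hP.measurableSet_isLocallyFinite) (tendsto_pi_nhds.2 fun w => ?_)
    by_cases hw : IsLocallyFinite (P w)
    · simp only [indicator, mem_ofPred_eq, hw, if_true, hw.voidMeasure_apply R hA]
      exact tendsto_tsum_voidIndicator hR hk hε hkc
        ((hw n).subset (inter_subset_inter_right _ hAn))
    · simp [indicator, hw, voidMeasure]
  refine Measure.measurable_of_measurable_coe _ fun A hA => ?_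
  have hsup (w : Ω) : voidMeasure R (P w) A =
      ⨆ n : ℕ, voidMeasure R (P w) (A ∩ Metric.closedBall 0 n) := by
    rw [← Monotone.measure_iUnion, ← inter_iUnion, Metric.iUnion_closedBall_nat, inter_univ]
    exact fun m n hmn => inter_subset_inter_right _
      (Metric.closedBall_subset_closedBall (by exact_mod_cast hmn))
  simp_rw [hsup]
  exact Measurable.iSup fun n => hbdd n (hA.inter measurableSet_closedBall) inter_subset_right

/-- Mecke's formula for the points of a Poisson process with no other point in their
`R`-neighbourhood. -/
theorem bind_voidMeasure (hP : IsPoissonProcess μ lam P) {R : Set (Plane × Plane)}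
    (hR : IsOpen R) (hfin : ∀ x, volume {y | (x, y) ∈ R} < ∞) :
    μ.bind (fun w => voidMeasure R (P w)) = volume.withDensity (voidDensity lam R) := by
  have hbdd (n : ℕ) {A : Set Plane} (hA : MeasurableSet A) (hAn : A ⊆ Metric.closedBall 0 n) :
      ∫⁻ w, voidMeasure R (P w) A ∂μ = ∫⁻ x in A, voidDensity lam R x := by
    obtain ⟨k, c, ε, hk, hε, hkc⟩ := exists_measurable_index_seq
    have hAfin : volume A < ∞ := (measure_mono hAn).trans_lt measure_closedBall_lt_top
    have hleft : Tendsto (fun n => ∫⁻ w, ∑' j, voidIndicator (P w)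
        (innerRegion R (k n) (c n) (ε n) j) * (P w ∩ (A ∩ k n ⁻¹' {j})).encard ∂μ) atTop
        (𝓝 (∫⁻ w, voidMeasure R (P w) A ∂μ)) := by
      refine tendsto_lintegral_of_dominated_convergence (fun w => (P w ∩ A).encard)
        (fun n => hP.measurable_tsum_voidIndicator hR (hk n) _ _ hA) (fun n => ?_) ?_ ?_
      · filter_upwards [hP.ae_isLocallyFinite] with w hw
        have hVA : MeasurableSet (P w ∩ A) := hw.countable.measurableSet.inter hA
        calc ∑' j, voidIndicator (P w) (innerRegion R (k n) (c n) (ε n) j) *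
              ((P w ∩ (A ∩ k n ⁻¹' {j})).encard : ℝ≥0∞)
            ≤ ∑' j, 1 * Measure.count.restrict (P w ∩ A) (k n ⁻¹' {j}) := by
              gcongr with j
              · exact voidIndicator_le_one _ _
              · have hj := hk n (measurableSet_singleton j)
                rw [Measure.restrict_apply hj, Measure.count_apply (hj.inter hVA),
                  inter_comm _ (P w ∩ A), inter_assoc]
          _ = (P w ∩ A).encard := by
              rw [← lintegral_comp_index _ (hk n) (fun _ => 1), lintegral_one,
                Measure.restrict_apply_univ, Measure.count_apply hVA]
      · rw [hP.lintegral_encard hA hAfin]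
        finiteness
      · filter_upwards [hP.ae_isLocallyFinite] with w hw
        rw [hw.voidMeasure_apply R hA]
        exact tendsto_tsum_voidIndicator hR hk hε hkc
          ((hw n).subset (inter_subset_inter_right _ hAn))
    have hright : Tendsto (fun n => ∫⁻ x in A, ENNReal.ofReal
        (Real.exp (-(lam * volume.real (innerRegion R (k n) (c n) (ε n) (k n x))))) * lam) atTop
        (𝓝 (∫⁻ x in A, voidDensity lam R x)) := by
      refine tendsto_lintegral_of_dominated_convergence (fun _ => (lam : ℝ≥0∞)) (fun n => ?_)
        (fun n => Eventually.of_forall fun x => ?_) ?_ (Eventually.of_forall fun x => ?_)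
      · exact (measurable_of_countable (fun j => ENNReal.ofReal
          (Real.exp (-(lam * volume.real (innerRegion R (k n) (c n) (ε n) j)))) *
            (lam : ℝ≥0∞))).comp (hk n)
      · refine mul_le_of_le_one_left' (ENNReal.ofReal_le_one.2 (Real.exp_le_one_iff.2 ?_))
        have : 0 ≤ (lam : ℝ) * volume.real (innerRegion R (k n) (c n) (ε n) (k n x)) := by
          positivity
        linarith
      · simp only [lintegral_const, Measure.restrict_apply_univ]
        finiteness
      · refine ENNReal.Tendsto.mul_const ?_ (Or.inr ENNReal.coe_ne_top)
        refine ENNReal.tendsto_ofReal ((Real.continuous_exp.tendsto _).comp ?_)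
        exact ((tendsto_volume_innerRegion hR hk hε hkc (hfin x)).const_mul _).neg
    refine tendsto_nhds_unique hleft (hright.congr fun n => ?_)
    exact (hP.lintegral_tsum_voidIndicator hR hfin (hk n) (hkc n) hA hAfin).symm
  have hmeas := (hP.measurable_voidMeasure hR).aemeasurable (μ := μ)
  refine (Measure.ext_iff_of_iUnion_eq_univ (Metric.iUnion_closedBall_nat (0 : Plane))).2
    fun n => Measure.ext fun A hA => ?_
  have hAn := hA.inter (measurableSet_closedBall (x := (0 : Plane)) (ε := n))
  rw [Measure.restrict_apply hA, Measure.restrict_apply hA, Measure.bind_apply hAn hmeas,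
    withDensity_apply _ hAn, hbdd n hAn inter_subset_right]

end IsPoissonProcess

/-! ### The area of two overlapping disks -/

/-- The half-width, at abscissa `x`, of the union of the two unit disks centred at `(± 1 / 2, 0)`;
it is `0` off the union, where the argument of the square root is not positive. -/
noncomputable def unionHalfWidth (x : ℝ) : ℝ := √(1 - (|x| - 1 / 2) ^ 2)

lemma continuous_unionHalfWidth : Continuous unionHalfWidth := by
  unfold unionHalfWidth
  fun_prop

lemma hasDerivAt_sqrt_one_sub_sq_primitive {t : ℝ} (h : t ∈ Ioo (-1 : ℝ) 1) :
    HasDerivAt (fun t => t * √(1 - t ^ 2) + Real.arcsin t) (2 * √(1 - t ^ 2)) t := by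
  have hpos : 0 < 1 - t ^ 2 := by nlinarith [h.1, h.2]
  have hs : HasDerivAt (fun t : ℝ => √(1 - t ^ 2)) ((-(2 * t)) / (2 * √(1 - t ^ 2))) t := by
    refine HasDerivAt.sqrt ?_ hpos.ne'
    simpa using (hasDerivAt_pow 2 t).const_sub 1
  have ha := Real.hasDerivAt_arcsin h.1.ne' h.2.ne
  refine (((hasDerivAt_id' t).mul hs).add ha).congr_deriv ?_
  have h0 : √(1 - t ^ 2) ≠ 0 := (Real.sqrt_pos.2 hpos).ne'
  have hsq : √(1 - t ^ 2) ^ 2 = 1 - t ^ 2 := Real.sq_sqrt hpos.le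
  field_simp
  rw [hsq]
  ring

lemma integral_unionHalfWidth_half :
    ∫ x in (0 : ℝ)..(3 / 2), 2 * unionHalfWidth x = nngOmega / 2 := by
  have hcongr : ∫ x in (0 : ℝ)..(3 / 2), 2 * unionHalfWidth x =
      ∫ x in (0 : ℝ)..(3 / 2), (fun t => 2 * √(1 - t ^ 2)) (x - 1 / 2) := by
    refine intervalIntegral.integral_congr fun x hx => ?_
    rw [uIcc_of_le (by norm_num)] at hx
    simp [unionHalfWidth, abs_of_nonneg hx.1]
  rw [hcongr, intervalIntegral.integral_comp_sub_right (fun t => 2 * √(1 - t ^ 2)),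
    intervalIntegral.integral_eq_sub_of_hasDerivAt_of_le (by norm_num)
      (f := fun t => t * √(1 - t ^ 2) + Real.arcsin t) (by fun_prop)
      (fun t ht => hasDerivAt_sqrt_one_sub_sq_primitive ⟨by linarith [ht.1], by linarith [ht.2]⟩)
      (Continuous.intervalIntegrable (by fun_prop) _ _)]
  have harc : Real.arcsin (1 / 2) = Real.pi / 6 := by
    rw [← Real.sin_pi_div_six, Real.arcsin_sin] <;> linarith [Real.pi_pos]
  have hsqrt : √(3 / 4 : ℝ) = √3 / 2 := by
    rw [show (3 / 4 : ℝ) = 3 / 2 ^ 2 by norm_num, Real.sqrt_div' _ (by norm_num),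
      Real.sqrt_sq (by norm_num)]
  have h1 : (3 / 2 - 1 / 2 : ℝ) = 1 := by norm_num
  have h2 : (0 - 1 / 2 : ℝ) = -(1 / 2) := by norm_num
  have h3 : (1 - (-(1 / 2)) ^ 2 : ℝ) = 3 / 4 := by norm_num
  rw [h1, h2, h3, Real.arcsin_neg, harc, hsqrt, Real.arcsin_one, nngOmega]
  norm_num
  ring

lemma nngOmega_pos : 0 < nngOmega := by
  have := Real.pi_pos
  unfold nngOmega
  positivity

lemma integral_unionHalfWidth :
    ∫ x in Ioo (-(3 / 2) : ℝ) (3 / 2), 2 * unionHalfWidth x = nngOmega := by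
  have hint (a b : ℝ) : IntervalIntegrable (fun x => 2 * unionHalfWidth x) volume a b :=
    (continuous_const.mul continuous_unionHalfWidth).intervalIntegrable _ _
  have hneg : ∫ x in (-(3 / 2) : ℝ)..0, 2 * unionHalfWidth x = nngOmega / 2 := by
    rw [← integral_unionHalfWidth_half, ← neg_zero, ← intervalIntegral.integral_comp_neg]
    simp [unionHalfWidth]
  rw [← integral_Ioc_eq_integral_Ioo, ← intervalIntegral.integral_of_le (by norm_num),
    ← intervalIntegral.integral_add_adjacent_intervals (hint _ 0) (hint 0 _), hneg,
    integral_unionHalfWidth_half]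
  ring

lemma volume_regionBetween_unionHalfWidth :
    volume (regionBetween (fun x => -unionHalfWidth x) unionHalfWidth
      (Ioo (-(3 / 2) : ℝ) (3 / 2))) = ENNReal.ofReal nngOmega := by
  have hint {f : ℝ → ℝ} (hf : Continuous f) : IntegrableOn f (Ioo (-(3 / 2) : ℝ) (3 / 2)) :=
    (hf.integrableOn_Icc).mono_set Ioo_subset_Icc_self
  rw [Measure.volume_eq_prod, volume_regionBetween_eq_integral
    (f := fun x => -unionHalfWidth x) (hint continuous_unionHalfWidth.neg)
    (hint continuous_unionHalfWidth) measurableSet_Ioo,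
    ← integral_unionHalfWidth]
  · congr 2 with x
    simp [two_mul]
  · intro x _
    have : 0 ≤ unionHalfWidth x := Real.sqrt_nonneg _
    linarith

/-- The union of the two disks is the region between the graphs of `± unionHalfWidth`. Open
disks are used because `regionBetween` is defined by strict inequalities. -/
lemma volume_ball_union_ball_horizontal :
    volume (Metric.ball (!₂[-(1 / 2), 0] : Plane) 1 ∪ Metric.ball (!₂[1 / 2, 0] : Plane) 1) =
      ENNReal.ofReal nngOmega := by
  have hmp := (volume_preserving_finTwoArrow ℝ).comp
    (EuclideanSpace.volume_preserving_symm_measurableEquiv_toLp (Fin 2))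
  have hpre : (MeasurableEquiv.finTwoArrow ∘ (MeasurableEquiv.toLp 2 (Fin 2 → ℝ)).symm) ⁻¹'
      (regionBetween (fun x => -unionHalfWidth x) unionHalfWidth (Ioo (-(3 / 2) : ℝ) (3 / 2))) =
      Metric.ball (!₂[-(1 / 2), 0] : Plane) 1 ∪ Metric.ball (!₂[1 / 2, 0] : Plane) 1 := by
    ext p
    have hball (a : ℝ) : p ∈ Metric.ball (!₂[a, 0] : Plane) 1 ↔ (p 0 - a) ^ 2 + p 1 ^ 2 < 1 := by
      rw [Metric.mem_ball, EuclideanSpace.dist_eq, Real.sqrt_lt' one_pos]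
      simp [Fin.sum_univ_two, Real.dist_eq, sq_abs]
    have hregion : (MeasurableEquiv.finTwoArrow ∘ (MeasurableEquiv.toLp 2 (Fin 2 → ℝ)).symm) p ∈
        regionBetween (fun x => -unionHalfWidth x) unionHalfWidth (Ioo (-(3 / 2) : ℝ) (3 / 2)) ↔
        p 0 ∈ Ioo (-(3 / 2) : ℝ) (3 / 2) ∧
          p 1 ∈ Ioo (-unionHalfWidth (p 0)) (unionHalfWidth (p 0)) := Iff.rfl
    rw [mem_preimage, hregion, mem_union, hball, hball, mem_Ioo (b := unionHalfWidth _), ← abs_lt,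
      unionHalfWidth, Real.lt_sqrt (abs_nonneg _), sq_abs]
    constructor
    · rintro ⟨-, h⟩
      rcases le_total 0 (p 0) with h0 | h0
      · rw [abs_of_nonneg h0] at h
        right; linarith
      · rw [abs_of_nonpos h0] at h
        left; nlinarith
    · intro h
      have h' : p 1 ^ 2 < 1 - (|p 0| - 1 / 2) ^ 2 := by
        rcases le_total 0 (p 0) with h0 | h0
        · rw [abs_of_nonneg h0]
          rcases h with h | h <;> nlinarith
        · rw [abs_of_nonpos h0]
          rcases h with h | h <;> nlinarith
      refine ⟨abs_lt.1 ?_, h'⟩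
      nlinarith [sq_nonneg (p 1), abs_nonneg (p 0)]
  rw [← hpre]
  have hmeas := measurableSet_regionBetween (f := fun x => -unionHalfWidth x)
    continuous_unionHalfWidth.neg.measurable continuous_unionHalfWidth.measurable
    (measurableSet_Ioo (a := (-(3 / 2) : ℝ)) (b := 3 / 2))
  rw [hmp.measure_preimage hmeas.nullMeasurableSet]
  exact volume_regionBetween_unionHalfWidth

lemma exists_linearIsometryEquiv_apply_eq {v w : Plane} (h : ‖v‖ = ‖w‖) :
    ∃ e : Plane ≃ₗᵢ[ℝ] Plane, e v = w :=
  ⟨_, Submodule.reflection_sub h⟩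

lemma volume_ball_union_ball_add (a u v : Plane) (r : ℝ) :
    volume (Metric.ball (u + a) r ∪ Metric.ball (v + a) r) =
      volume (Metric.ball u r ∪ Metric.ball v r) := by
  rw [← measure_preimage_add_right volume a (Metric.ball (u + a) r ∪ Metric.ball (v + a) r)]
  congr 1
  ext x
  simp

lemma volume_ball_union_ball_of_dist_eq_one {u v : Plane} (h : dist u v = 1) :
    volume (Metric.ball u 1 ∪ Metric.ball v 1) = ENNReal.ofReal nngOmega := by
  set p : Plane := !₂[-(1 / 2), 0] with hp
  set q : Plane := !₂[1 / 2, 0] with hq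
  have hpq : ‖q - p‖ = 1 := by
    rw [EuclideanSpace.norm_eq]
    simp [hp, hq, Fin.sum_univ_two]
    norm_num
  obtain ⟨e, he⟩ := exists_linearIsometryEquiv_apply_eq (v := v - u) (w := q - p)
    (by rw [hpq, ← h, dist_comm, dist_eq_norm])
  have h1 := volume_ball_union_ball_add (-u) u v 1
  have h2 := volume_ball_union_ball_add (-p) p q 1
  rw [add_neg_cancel, ← sub_eq_add_neg] at h1 h2
  have h3 := e.measurePreserving.measure_preimage
    ((Metric.isOpen_ball (x := 0) (ε := 1)).union
      (Metric.isOpen_ball (x := q - p) (ε := 1))).measurableSet.nullMeasurableSet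
  rw [preimage_union, e.preimage_ball, e.preimage_ball, map_zero, ← he, e.symm_apply_apply, he]
    at h3
  rw [← h1, h3, h2, hp, hq, volume_ball_union_ball_horizontal]

lemma volume_closedBall_union_closedBall_of_dist_eq_one {u v : Plane} (h : dist u v = 1) :
    volume (Metric.closedBall u 1 ∪ Metric.closedBall v 1) = ENNReal.ofReal nngOmega := by
  have hae (x : Plane) : (Metric.closedBall x 1 : Set Plane) =ᵐ[volume] Metric.ball x 1 := by
    rw [← Metric.ball_union_sphere]
    exact union_ae_eq_left_of_ae_eq_empty (ae_eq_empty.2 (Measure.addHaar_sphere _ _ _))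
  rw [measure_congr ((hae u).union (hae v)), volume_ball_union_ball_of_dist_eq_one h]

open scoped Pointwise in
lemma volume_ball_zero_union_ball_norm (x : Plane) :
    volume (Metric.ball 0 ‖x‖ ∪ Metric.ball x ‖x‖) =
      ENNReal.ofReal (nngOmega * ‖x‖ ^ 2) := by
  rcases eq_or_ne x 0 with rfl | hx
  · simp
  have hx' : 0 < ‖x‖ := norm_pos_iff.2 hx
  have hdist : dist (0 : Plane) (‖x‖⁻¹ • x) = 1 := by
    rw [dist_zero_left, norm_smul, norm_inv, norm_norm, inv_mul_cancel₀ hx'.ne']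
  have hsmul : Metric.ball (0 : Plane) ‖x‖ ∪ Metric.ball x ‖x‖ =
      ‖x‖ • (Metric.ball (0 : Plane) 1 ∪ Metric.ball (‖x‖⁻¹ • x) 1) := by
    rw [smul_set_union, smul_ball hx'.ne', smul_ball hx'.ne']
    simp [smul_smul, hx'.ne']
  rw [hsmul, Measure.addHaar_smul, volume_ball_union_ball_of_dist_eq_one hdist,
    ← ENNReal.ofReal_mul (abs_nonneg _)]
  simp [mul_comm]

/-! ### Expected sums over points with an empty neighbourhood -/

lemma Set.Finite.integrableOn_count {S : Set Plane} (hS : S.Finite) (h : Plane → ℝ) :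
    IntegrableOn h S Measure.count := by
  have : IsFiniteMeasure (Measure.count.restrict S) :=
    ⟨by simpa [Measure.count_apply hS.measurableSet] using hS⟩
  have hint := IntegrableOn.of_finite (μ := Measure.count.restrict S) (f := h) hS
  rwa [IntegrableOn, Measure.restrict_restrict hS.measurableSet, inter_self] at hint

lemma Set.Finite.tsum_eq_setIntegral_count {S : Set Plane} (hS : S.Finite) (h : Plane → ℝ) :
    ∑' x : S, h x = ∫ x in S, h x ∂Measure.count := by
  have hint := hS.integrableOn_count h
  lift S to Finset Plane using hS
  rw [Finset.tsum_subtype' S h, setIntegral_finset S hint]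
  simp [Measure.real]

namespace IsPoissonProcess

variable {Ω : Type*} [MeasurableSpace Ω] {μ : Measure Ω} {lam : ℝ≥0} {P : Ω → Set Plane}

lemma lintegral_lintegral_voidMeasure (hP : IsPoissonProcess μ lam P) {R : Set (Plane × Plane)}
    (hR : IsOpen R) (hfin : ∀ x, volume {y | (x, y) ∈ R} < ∞) {φ : Plane → ℝ≥0∞}
    (hφ : Measurable φ) :
    ∫⁻ w, ∫⁻ x, φ x ∂voidMeasure R (P w) ∂μ =
      ∫⁻ x, φ x ∂volume.withDensity (voidDensity lam R) := by
  rw [← hP.bind_voidMeasure hR hfin,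
    Measure.lintegral_bind (hP.measurable_voidMeasure hR).aemeasurable hφ.aemeasurable]

lemma ae_finite_voidPoints (hP : IsPoissonProcess μ lam P) {R : Set (Plane × Plane)}
    (hR : IsOpen R) (hfin : ∀ x, volume {y | (x, y) ∈ R} < ∞)
    (hdens : ∫⁻ x, voidDensity lam R x ≠ ∞) : ∀ᵐ w ∂μ, (voidPoints R (P w)).Finite := by
  have hint := hP.lintegral_lintegral_voidMeasure hR hfin (φ := fun _ => 1) measurable_const
  simp only [lintegral_one, withDensity_apply _ MeasurableSet.univ, Measure.restrict_univ] at hint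
  have hmeas : Measurable fun w => voidMeasure R (P w) univ :=
    (Measure.measurable_coe MeasurableSet.univ).comp (hP.measurable_voidMeasure hR)
  filter_upwards [ae_lt_top hmeas (hint ▸ hdens), hP.ae_isLocallyFinite] with w hw hloc
  rw [hloc.voidMeasure_apply R MeasurableSet.univ, inter_univ] at hw
  rw [← Set.encard_lt_top_iff]
  simpa using hw

/-- Mecke's formula for bounded real-valued summands. -/
lemma integrable_and_integral_voidPoints (hP : IsPoissonProcess μ lam P)
    {R : Set (Plane × Plane)} (hR : IsOpen R) (hfin : ∀ x, volume {y | (x, y) ∈ R} < ∞)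
    (hdens : ∫⁻ x, voidDensity lam R x ≠ ∞) {h : Plane → ℝ} (hh : Measurable h) {C : ℝ}
    (hC : ∀ x, |h x| ≤ C) :
    Integrable (fun w => ∫ x in voidPoints R (P w), h x ∂Measure.count) μ ∧
      ∫ w, ∫ x in voidPoints R (P w), h x ∂Measure.count ∂μ =
        ∫ x, h x ∂volume.withDensity (voidDensity lam R) := by
  set ν := volume.withDensity (voidDensity lam R) with hν
  have hνfin : IsFiniteMeasure ν := isFiniteMeasure_withDensity hdens
  have hint : Integrable h ν :=
    Integrable.of_bound hh.aestronglyMeasurable C (Eventually.of_forall hC)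
  have key {φ : Plane → ℝ} (hφ : Measurable φ) (hφC : ∀ x, φ x ≤ C) :
      Integrable (fun w => (∫⁻ x, ENNReal.ofReal (φ x) ∂voidMeasure R (P w)).toReal) μ ∧
        ∫ w, (∫⁻ x, ENNReal.ofReal (φ x) ∂voidMeasure R (P w)).toReal ∂μ =
          (∫⁻ x, ENNReal.ofReal (φ x) ∂ν).toReal := by
    have hmeas : Measurable fun w => ∫⁻ x, ENNReal.ofReal (φ x) ∂voidMeasure R (P w) :=
      (Measure.measurable_lintegral hφ.ennreal_ofReal).comp (hP.measurable_voidMeasure hR)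
    have heq := hP.lintegral_lintegral_voidMeasure hR hfin hφ.ennreal_ofReal
    have htop : ∫⁻ x, ENNReal.ofReal (φ x) ∂ν ≠ ∞ := by
      refine ((lintegral_mono fun x => ENNReal.ofReal_le_ofReal (hφC x)).trans_lt
        (b := ∫⁻ _, ENNReal.ofReal C ∂ν) ?_).ne
      rw [lintegral_const]
      finiteness
    rw [← hν] at heq
    exact ⟨integrable_toReal_of_lintegral_ne_top hmeas.aemeasurable (heq ▸ htop),
      by rw [integral_toReal hmeas.aemeasurable (ae_lt_top hmeas (heq ▸ htop)), heq]⟩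
  obtain ⟨hpos, hpos'⟩ := key hh fun x => (le_abs_self _).trans (hC x)
  obtain ⟨hneg, hneg'⟩ := key (φ := fun x => -h x) hh.neg fun x => (neg_le_abs _).trans (hC x)
  have hae : (fun w => ∫ x in voidPoints R (P w), h x ∂Measure.count) =ᵐ[μ] fun w =>
      (∫⁻ x, ENNReal.ofReal (h x) ∂voidMeasure R (P w)).toReal -
        (∫⁻ x, ENNReal.ofReal (-h x) ∂voidMeasure R (P w)).toReal := by
    filter_upwards [hP.ae_finite_voidPoints hR hfin hdens, hP.ae_isLocallyFinite] with w hw hloc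
    rw [hloc.voidMeasure_eq,
      integral_eq_lintegral_pos_part_sub_lintegral_neg_part (hw.integrableOn_count h)]
  refine ⟨(hpos.sub hneg).congr hae.symm, ?_⟩
  rw [integral_congr_ae hae, integral_sub hpos hneg,
    integral_eq_lintegral_pos_part_sub_lintegral_neg_part hint]
  exact congrArg₂ _ hpos' hneg'

lemma ae_zero_notMem (hP : IsPoissonProcess μ lam P) : ∀ᵐ w ∂μ, (0 : Plane) ∉ P w := by
  have h := hP.lintegral_encard (A := {0}) (measurableSet_singleton _) (by simp)
  rw [measure_singleton, mul_zero,
    lintegral_eq_zero_iff (hP.measurable_encard (measurableSet_singleton _))] at h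
  filter_upwards [h] with w hw h0
  simp [inter_singleton_of_mem h0] at hw

end IsPoissonProcess

/-! ### Radial densities and the Rayleigh law -/

lemma measurable_rayleigh_density (s : ℝ) : Measurable fun z : ℝ =>
    if 0 ≤ z then ENNReal.ofReal (z / s * Real.exp (-z ^ 2 / (2 * s))) else 0 :=
  Measurable.ite measurableSet_Ici (by fun_prop) measurable_const

lemma ae_nonneg_rayleighMeasure (s : ℝ) : ∀ᵐ z ∂rayleighMeasure s, 0 ≤ z := by
  rw [rayleighMeasure, ae_withDensity_iff (measurable_rayleigh_density s)]
  exact Eventually.of_forall fun z hz => by_contra fun h => hz (if_neg h)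

lemma integral_rayleighMeasure {s : ℝ} (hs : 0 < s) (H : ℝ → ℝ) :
    ∫ z, H z ∂rayleighMeasure s =
      ∫ z in Ioi 0, z / s * Real.exp (-z ^ 2 / (2 * s)) * H z := by
  rw [rayleighMeasure, integral_withDensity_eq_integral_toReal_smul (measurable_rayleigh_density s)
    (Eventually.of_forall fun z => by split_ifs <;> simp), ← integral_Ici_eq_integral_Ioi,
    ← integral_indicator measurableSet_Ici]
  refine integral_congr_ae (Eventually.of_forall fun z => ?_)
  by_cases hz : 0 ≤ z
  · simp only [if_pos hz, indicator_of_mem (mem_Ici.2 hz), smul_eq_mul]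
    rw [ENNReal.toReal_ofReal (by positivity)]
  · simp [hz]

lemma volume_real_ball_zero_one : volume.real (Metric.ball (0 : Plane) 1) = Real.pi := by
  rw [Measure.real, EuclideanSpace.volume_ball_fin_two]
  simp [Real.pi_pos.le]

section Radial

variable {lam : ℝ≥0} {R : Set (Plane × Plane)} {c : ℝ}

lemma toReal_voidDensity (hc : ∀ x : Plane, volume.real {y | (x, y) ∈ R} = c * ‖x‖ ^ 2)
    (x : Plane) :
    (voidDensity lam R x).toReal = Real.exp (-(lam * (c * ‖x‖ ^ 2))) * lam := by
  rw [voidDensity, hc, ENNReal.toReal_mul, ENNReal.toReal_ofReal (Real.exp_pos _).le,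
    ENNReal.coe_toReal]

lemma voidDensity_lt_top (x : Plane) : voidDensity lam R x < ∞ :=
  ENNReal.mul_lt_top ENNReal.ofReal_lt_top ENNReal.coe_lt_top

lemma lintegral_voidDensity_ne_top (hlam : 0 < lam) (hc0 : 0 < c)
    (hc : ∀ x : Plane, volume.real {y | (x, y) ∈ R} = c * ‖x‖ ^ 2) :
    ∫⁻ x, voidDensity lam R x ≠ ∞ := by
  have hb : 0 < (lam : ℝ) * c := mul_pos hlam hc0
  have hint : Integrable fun x : Plane =>
      (fun r : ℝ => Real.exp (-(lam * (c * r ^ 2))) * lam) ‖x‖ := by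
    refine (integrable_fun_norm_addHaar (E := Plane) volume
      (f := fun r : ℝ => Real.exp (-(lam * (c * r ^ 2))) * lam)).2
      (((integrable_mul_exp_neg_mul_sq hb).const_mul (lam : ℝ)).congr
      (Eventually.of_forall fun r => ?_)).integrableOn
    simp only [finrank_euclideanSpace_fin, smul_eq_mul]
    rw [show -(lam * (c * r ^ 2)) = -(lam * c) * r ^ 2 by ring]
    ring
  have hfin := hint.lintegral_lt_top
  simp only [← toReal_voidDensity hc, ENNReal.ofReal_toReal (voidDensity_lt_top _).ne] at hfin
  exact hfin.ne

/-- In polar coordinates, the Gaussian density `lam * exp (- c * lam * ‖x‖ ^ 2)` is `π / c` times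
the Rayleigh density of the norm. -/
lemma integral_withDensity_voidDensity (hR : IsOpen R) (hlam : 0 < lam) (hc0 : 0 < c)
    (hc : ∀ x : Plane, volume.real {y | (x, y) ∈ R} = c * ‖x‖ ^ 2) (H : ℝ → ℝ) :
    ∫ x, H ‖x‖ ∂volume.withDensity (voidDensity lam R) =
      Real.pi / c * ∫ z, H z ∂rayleighMeasure (1 / (2 * c * lam)) := by
  have hlam' : 0 < (lam : ℝ) := hlam
  rw [integral_withDensity_eq_integral_toReal_smul (measurable_voidDensity lam hR)
    (Eventually.of_forall voidDensity_lt_top), integral_rayleighMeasure (by positivity)]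
  simp_rw [toReal_voidDensity hc]
  rw [integral_fun_norm_addHaar volume
    (fun r : ℝ => (Real.exp (-(lam * (c * r ^ 2))) * lam) • H r), volume_real_ball_zero_one]
  simp only [finrank_euclideanSpace_fin, nsmul_eq_mul, smul_eq_mul]
  rw [← integral_const_mul, ← integral_const_mul, ← integral_const_mul]
  refine setIntegral_congr_fun measurableSet_Ioi fun r _ => ?_
  have hexp : -r ^ 2 / (2 * (1 / (2 * c * lam))) = -(lam * (c * r ^ 2)) := by
    field_simp
  simp only [hexp]
  push_cast
  field_simp

end Radial

/-! ### Neighbours of the origin -/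

/-- The pairs `(x, y)` such that `y` is strictly closer to the origin than `x` is: a point `y` of
the process stops `x` from being a nearest neighbour of the origin iff `(x, y)` is in this set. -/
def closerToOrigin : Set (Plane × Plane) := {p | ‖p.2‖ < ‖p.1‖}

/-- The pairs `(x, y)` such that `y` is strictly closer to `x` than the origin is. -/
def closerThanOrigin : Set (Plane × Plane) := {p | dist p.2 p.1 < ‖p.1‖}

lemma isOpen_closerToOrigin : IsOpen closerToOrigin :=
  isOpen_lt (by fun_prop) (by fun_prop)

lemma isOpen_closerThanOrigin : IsOpen closerThanOrigin :=
  isOpen_lt (by fun_prop) (by fun_prop)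

lemma section_closerToOrigin (x : Plane) :
    {y | (x, y) ∈ closerToOrigin} = Metric.ball 0 ‖x‖ := by
  ext y; simp [closerToOrigin]

lemma section_closerThanOrigin (x : Plane) :
    {y | (x, y) ∈ closerThanOrigin} = Metric.ball x ‖x‖ := by
  ext y; simp [closerThanOrigin]

lemma section_union (x : Plane) :
    {y | (x, y) ∈ closerToOrigin ∪ closerThanOrigin} =
      Metric.ball 0 ‖x‖ ∪ Metric.ball x ‖x‖ := by
  rw [← section_closerToOrigin, ← section_closerThanOrigin]
  rfl

lemma volume_real_ball (x : Plane) {r : ℝ} (hr : 0 ≤ r) :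
    volume.real (Metric.ball x r) = Real.pi * r ^ 2 := by
  rw [Measure.real, EuclideanSpace.volume_ball_fin_two, ← ENNReal.ofReal_pow hr,
    ← ENNReal.ofReal_mul (by positivity), ENNReal.toReal_ofReal (by positivity), mul_comm]

lemma voidPoints_inter (R R' : Set (Plane × Plane)) (V : Set Plane) :
    voidPoints R V ∩ voidPoints R' V = voidPoints (R ∪ R') V := by
  ext x
  simp only [voidPoints, mem_inter_iff, mem_ofPred_eq, mem_union, not_or]
  grind

lemma originNeighbors_eq {V : Set Plane} (hV : (0 : Plane) ∉ V) :
    originNeighbors V = voidPoints closerToOrigin V ∪ voidPoints closerThanOrigin V := by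
  ext x
  simp only [originNeighbors, nearestNeighborGraph, IsNearestNeighbor, voidPoints, closerToOrigin,
    closerThanOrigin, mem_ofPred_eq, mem_union, mem_singleton_iff, not_lt]
  constructor
  · rintro ⟨hx, -, -, h0, h | h⟩
    · refine Or.inl ⟨hx, fun y hy _ => ?_⟩
      simpa using h.2.2 y (Or.inl hy) (by rintro rfl; exact hV hy)
    · refine Or.inr ⟨hx, fun y hy hyx => ?_⟩
      simpa [dist_comm] using h.2.2 y (Or.inl hy) hyx
  · have hne (hx : x ∈ V) : x ≠ 0 := by rintro rfl; exact hV hx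
    rintro (⟨hx, h⟩ | ⟨hx, h⟩)
    · refine ⟨hx, Or.inr trivial, Or.inl hx, (hne hx).symm, Or.inl ⟨Or.inl hx, hne hx, ?_⟩⟩
      rintro z (hz | hz) hz0
      · rcases eq_or_ne z x with rfl | hzx
        · exact le_rfl
        · simpa using h z hz hzx
      · exact absurd hz hz0
    · refine ⟨hx, Or.inr trivial, Or.inl hx, (hne hx).symm,
        Or.inr ⟨Or.inr trivial, (hne hx).symm, ?_⟩⟩
      rintro z (hz | rfl) hzx
      · simpa [dist_comm] using h z hz hzx
      · exact le_rfl

/-- Inclusion–exclusion for the two ways of being joined to the origin. -/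
lemma originEdgeSum_eq {V : Set Plane} (hV : (0 : Plane) ∉ V)
    (h₁ : (voidPoints closerToOrigin V).Finite) (h₂ : (voidPoints closerThanOrigin V).Finite)
    (K : ℝ) (g : ℝ → ℝ) {h : Plane → ℝ} (hh : ∀ x, h x = edgeFun K (g (dist 0 x))) :
    originEdgeSum K g V =
      (∫ x in voidPoints closerToOrigin V, h x ∂Measure.count) +
        (∫ x in voidPoints closerThanOrigin V, h x ∂Measure.count) -
        ∫ x in voidPoints (closerToOrigin ∪ closerThanOrigin) V, h x ∂Measure.count := by
  have hsum : originEdgeSum K g V = ∑' x : originNeighbors V, h x := by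
    simp only [originEdgeSum, hh]
  rw [hsum, originNeighbors_eq hV, (h₁.union h₂).tsum_eq_setIntegral_count, eq_sub_iff_add_eq,
    ← voidPoints_inter,
    ← integral_add_measure ((h₁.union h₂).integrableOn_count h)
      ((h₁.inter_of_left _).integrableOn_count h),
    Measure.restrict_union_add_inter _ h₂.measurableSet,
    integral_add_measure (h₁.integrableOn_count h) (h₂.integrableOn_count h)]

/-! ### The edge functional -/

lemma measurable_edgeFun (K : ℝ) : Measurable (edgeFun K) := by
  unfold edgeFun
  fun_prop

lemma exists_abs_edgeFun_le {K : ℝ} (hK : 0 < K) {M : ℝ} (hM : M < 1) :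
    ∃ C, ∀ x ∈ Icc 0 M, |edgeFun K x| ≤ C := by
  refine isCompact_Icc.exists_bound_of_continuousOn (f := edgeFun K) fun x hx => ?_
  have h : 0 < 1 - x ^ 2 := by nlinarith [hx.1, hx.2]
  unfold edgeFun
  refine ContinuousAt.continuousWithinAt (ContinuousAt.add ?_ ?_)
  · exact ContinuousAt.log (by fun_prop) h.ne'
  · exact ContinuousAt.div (by fun_prop) (by fun_prop) (by positivity)

/-- `F` need not be measurable on the negative half-line, which a Rayleigh variable avoids. -/
lemma integral_comp_eq_rayleigh {Ω : Type*} [MeasurableSpace Ω] {μ : Measure Ω} {s : ℝ}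
    {Z : Ω → ℝ} (hZ : HasLaw Z (rayleighMeasure s) μ) {H F : ℝ → ℝ} (hH : Measurable H)
    (hHF : ∀ z, 0 ≤ z → H z = F z) [IsProbabilityMeasure μ] {C : ℝ} (hC : ∀ z, |H z| ≤ C) :
    Integrable (fun w => F (Z w)) μ ∧ ∫ w, F (Z w) ∂μ = ∫ z, H z ∂rayleighMeasure s := by
  have hnonneg : ∀ᵐ w ∂μ, 0 ≤ Z w :=
    (hZ.ae_iff (measurableSet_Ici.mem)).2 (ae_nonneg_rayleighMeasure s)
  have hae : (fun w => H (Z w)) =ᵐ[μ] fun w => F (Z w) := by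
    filter_upwards [hnonneg] with w hw using hHF _ hw
  have hint : Integrable (fun w => H (Z w)) μ :=
    Integrable.of_bound (hH.comp_aemeasurable hZ.aemeasurable).aestronglyMeasurable C
      (Eventually.of_forall fun w => hC (Z w))
  refine ⟨hint.congr hae, ?_⟩
  rw [← integral_congr_ae hae]
  exact hZ.integral_comp hH.aestronglyMeasurable

theorem lemma3
    {Ω : Type*} [MeasurableSpace Ω] (μ : Measure Ω) [IsProbabilityMeasure μ]
    (lam : ℝ≥0) (hlam : 0 < lam)
    (P : Ω → Set Plane) (hP : IsPoissonProcess μ lam P)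
    (K : ℝ) (hK : 0 < K)
    (g : ℝ → ℝ) (hg_anti : AntitoneOn g (Set.Ici 0)) (hg_nonneg : ∀ r, 0 ≤ r → 0 ≤ g r)
    (hg_zero : g 0 < 1)
    {Ω₁ : Type*} [MeasurableSpace Ω₁] (μ₁ : Measure Ω₁) [IsProbabilityMeasure μ₁]
    (Z₁ : Ω₁ → ℝ) (hZ₁ : HasLaw Z₁ (rayleighMeasure (1 / (2 * Real.pi * lam))) μ₁)
    {Ω₂ : Type*} [MeasurableSpace Ω₂] (μ₂ : Measure Ω₂) [IsProbabilityMeasure μ₂]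
    (Z₂ : Ω₂ → ℝ) (hZ₂ : HasLaw Z₂ (rayleighMeasure (1 / (2 * nngOmega * lam))) μ₂) :
    (∀ u v : Plane, dist u v = 1 →
      volume (Metric.closedBall u 1 ∪ Metric.closedBall v 1) = ENNReal.ofReal nngOmega) ∧
    (∀ᵐ w ∂μ, (originNeighbors (P w)).Finite) ∧
    Integrable (fun w => originEdgeSum K g (P w)) μ ∧
    Integrable (fun w => edgeFun K (g (Z₁ w))) μ₁ ∧
    Integrable (fun w => edgeFun K (g (Z₂ w))) μ₂ ∧
    (1 / 2 : ℝ) * ∫ w, originEdgeSum K g (P w) ∂μ =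
      (∫ w, edgeFun K (g (Z₁ w)) ∂μ₁) -
        Real.pi / (2 * nngOmega) * ∫ w, edgeFun K (g (Z₂ w)) ∂μ₂ := by
  -- `g` is only controlled on `[0, ∞)`; its values at negative arguments are replaced by `g 0`.
  set H : ℝ → ℝ := fun r => edgeFun K (g (max r 0)) with hH
  have hHmeas : Measurable H := by
    have : Antitone fun r => g (max r 0) := fun a b hab =>
      hg_anti (le_max_right a 0) (le_max_right b 0) (max_le_max_right 0 hab)
    exact (measurable_edgeFun K).comp this.measurable
  have hHeq (r : ℝ) (hr : 0 ≤ r) : H r = edgeFun K (g r) := by simp only [hH, max_eq_left hr]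
  obtain ⟨C, hC⟩ := exists_abs_edgeFun_le hK hg_zero
  have hHC (r : ℝ) : |H r| ≤ C :=
    hC _ ⟨hg_nonneg _ (le_max_right r 0),
      hg_anti self_mem_Ici (le_max_right r 0) (le_max_right r 0)⟩
  have hmecke {R : Set (Plane × Plane)} (hR : IsOpen R) {c : ℝ} (hc0 : 0 < c)
      (hfin : ∀ x, volume {y | (x, y) ∈ R} < ∞)
      (hc : ∀ x : Plane, volume.real {y | (x, y) ∈ R} = c * ‖x‖ ^ 2) :
      (∀ᵐ w ∂μ, (voidPoints R (P w)).Finite) ∧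
        Integrable (fun w => ∫ x in voidPoints R (P w), H ‖x‖ ∂Measure.count) μ ∧
        ∫ w, ∫ x in voidPoints R (P w), H ‖x‖ ∂Measure.count ∂μ =
          Real.pi / c * ∫ z, H z ∂rayleighMeasure (1 / (2 * c * lam)) := by
    have hdens := lintegral_voidDensity_ne_top hlam hc0 hc
    refine ⟨hP.ae_finite_voidPoints hR hfin hdens, ?_⟩
    rw [← integral_withDensity_voidDensity hR hlam hc0 hc]
    exact hP.integrable_and_integral_voidPoints hR hfin hdens (hHmeas.comp measurable_norm)
      fun x => hHC ‖x‖
  obtain ⟨hfin₁, hint₁, hval₁⟩ := hmecke isOpen_closerToOrigin Real.pi_pos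
    (fun x => by rw [section_closerToOrigin]; exact measure_ball_lt_top)
    (fun x => by rw [section_closerToOrigin, volume_real_ball _ (norm_nonneg x)])
  obtain ⟨hfin₂, hint₂, hval₂⟩ := hmecke isOpen_closerThanOrigin Real.pi_pos
    (fun x => by rw [section_closerThanOrigin]; exact measure_ball_lt_top)
    (fun x => by rw [section_closerThanOrigin, volume_real_ball _ (norm_nonneg x)])
  obtain ⟨-, hint₃, hval₃⟩ := hmecke (isOpen_closerToOrigin.union isOpen_closerThanOrigin)
    nngOmega_pos
    (fun x => by rw [section_union, volume_ball_zero_union_ball_norm]; exact ENNReal.ofReal_lt_top)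
    (fun x => by
      have := nngOmega_pos
      rw [section_union, Measure.real, volume_ball_zero_union_ball_norm,
        ENNReal.toReal_ofReal (by positivity)])
  have hae : (fun w => originEdgeSum K g (P w)) =ᵐ[μ] fun w =>
      (∫ x in voidPoints closerToOrigin (P w), H ‖x‖ ∂Measure.count) +
        (∫ x in voidPoints closerThanOrigin (P w), H ‖x‖ ∂Measure.count) -
        ∫ x in voidPoints (closerToOrigin ∪ closerThanOrigin) (P w), H ‖x‖ ∂Measure.count := by
    filter_upwards [hfin₁, hfin₂, hP.ae_zero_notMem] with w h₁ h₂ h0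
    exact originEdgeSum_eq h0 h₁ h₂ K g fun x => by
      rw [dist_zero_left, hHeq _ (norm_nonneg x)]
  obtain ⟨hZint₁, hZval₁⟩ := integral_comp_eq_rayleigh hZ₁ hHmeas hHeq hHC
  obtain ⟨hZint₂, hZval₂⟩ := integral_comp_eq_rayleigh hZ₂ hHmeas hHeq hHC
  refine ⟨fun u v => volume_closedBall_union_closedBall_of_dist_eq_one, ?_,
    ((hint₁.add hint₂).sub hint₃).congr hae.symm, hZint₁, hZint₂, ?_⟩
  · filter_upwards [hfin₁, hfin₂, hP.ae_zero_notMem] with w h₁ h₂ h0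
    rw [originNeighbors_eq h0]
    exact h₁.union h₂
  · have hsum := integral_sub (hint₁.add hint₂) hint₃
    simp only [Pi.add_apply] at hsum
    rw [integral_congr_ae hae, hsum, integral_add hint₁ hint₂, hval₁, hval₂, hval₃, hZval₁, hZval₂,
      div_self Real.pi_ne_zero]
    field_simp
    ring
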